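/- Let $G(\mathbb{Z})$ be the Golomb space of $\mathbb{Z}$, i.e. the set $\mathbb{Z}\setminus\{0\}$ endowed with the topology generated by the coprime cosets $a+I$, where $a\in\mathbb{Z}$ and $I$ is a nonzero ideal of $\mathbb{Z}$ such that $a$ and $I$ together generate the unit ideal (the coset being intersected with $\mathbb{Z}\setminus\{0\}$ when $I=\mathbb{Z}$). For $n\in\mathbb{Z}$ put $$n^\star:=\begin{cases} n^2-1 & \text{if } n \text{ is even},\\ \dfrac{n^2-1}{4} & \text{if } n\text{ is odd}.\end{cases}$$ Let $h$ be a self-homeomorphism of $G(\mathbb{Z})$, extended to a map $\mathbb{Z}\to\mathbb{Z}$ by $h(0):=0$, and let $n\in\mathbb{Z}$ with $|n|>1$. If $n^\star=p_1^{e_1}\cdots p_t^{e_t}$ with $p_1,\dots,p_t$ distinct (positive) prime numbers and all $e_i\geq 1$, then there are distinct prime numbers $q_1,\dots,q_t$ such that $h(p_i\mathbb{Z})=q_i\mathbb{Z}$ for every $i$ and $$h(n)^\star=q_1^{e_1}\cdots q_t^{e_t}.$$ -/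

import Mathlib

/-- The points of the Golomb space `G(R)`: the nonzero elements of `R`. -/
@[ext]
structure GolombSpace (R : Type*) [CommRing R] where
  val : R
  ne_zero : val ≠ 0

namespace GolombSpace

/-- The trace on `R \ {0}` of the coset `a + I`. It is all of `a + I` unless `0 ∈ a + I`, which for
a coprime coset happens only when `I = R`. -/
def coset {R : Type*} [CommRing R] (a : R) (I : Ideal R) : Set (GolombSpace R) :=
  {x | ∃ i ∈ I, x.val = a + i}

/-- The Golomb topology: it is generated by the coprime cosets `a + I`, where `I` is a nonzero ideal
and the ideal generated by `a` and `I` is `R`. -/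
instance instTopologicalSpace {R : Type*} [CommRing R] : TopologicalSpace (GolombSpace R) :=
  TopologicalSpace.generateFrom
    {U | ∃ (a : R) (I : Ideal R), I ≠ ⊥ ∧ Ideal.span {a} ⊔ I = ⊤ ∧ U = coset a I}

open Classical in
/-- The extension `R → S` of a map `h : G(R) → G(S)` which sends `0` to `0`. -/
noncomputable def extend {R S : Type*} [CommRing R] [CommRing S]
    (h : GolombSpace R → GolombSpace S) (x : R) : S :=
  if hx : x = 0 then 0 else (h ⟨x, hx⟩).val

end GolombSpace

/-- `n⋆ = n² - 1` for `n` even and `n⋆ = (n² - 1) / 4` (an exact division) for `n` odd. -/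
def nStar (n : ℤ) : ℤ :=
  if Even n then n ^ 2 - 1 else (n ^ 2 - 1) / 4

/-! Closed neighbourhoods detect prime divisors: for x ≠ y, some closed neighbourhoods of x and y
meet inside pℤ exactly when p divides neither point. So for a unit u the filter `closureFilter u y`
records which primes divide y. It follows that h preserves units and the inclusion between sets of
prime divisors, hence permutes the sets pℤ (`exists_mapsMultiples`).

Let h(pℤ) = qℤ. Off pℤ, h is continuous from the p-adic to the q-adic topology, since a splitting of
ℤ ∖ pℤ by open sets is p-adically open. If h(rℤ) = sℤ, then h also maps the set of all ± r^m, the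
nonzero integers with no prime divisor other than r, to that of all ± s^m. So the relation
`PowAdherent` between primes is invariant.

If p^e exactly divides x⋆ and e ≥ 1, the integers p-adically adherent to the ± x^m are the y with
p^e ∣ y⋆: the number x⋆ measures how close x is to ±1, and 1 + p^f ℤ_p is procyclic (f ≥ 2 if p =
2). Such sets form a chain, whereas for a prime r ≠ p with p ∤ r⋆ there are two incomparable ones
below that of r. This makes p ∣ r⋆ invariant for primes r, and p^e ∣ r⋆ follows by induction on e;
Dirichlet's theorem supplies the auxiliary primes. Comparing n with a prime r such that p^e exactly
divides r⋆ gives p^e ∣ n⋆ ↔ q^e ∣ h(n)⋆. -/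

open Filter Topology

/-! ### Neighbourhoods and closures in the Golomb space -/

namespace GolombSpace

/-- The trace on `ℤ \ {0}` of the residue class of `a` modulo `d`. -/
def residueClass (a d : ℤ) : Set (GolombSpace ℤ) := {y | d ∣ y.val - a}

theorem exists_val_of_dvd (w m : ℤ) (hm : m ≠ 0) :
    ∃ z : GolombSpace ℤ, m ∣ z.val - w := by
  by_cases hw : w = 0
  · exact ⟨⟨m, hm⟩, by simp [hw]⟩
  · exact ⟨⟨w, hw⟩, by simp⟩

theorem isOpen_iff {U : Set (GolombSpace ℤ)} :
    IsOpen U ↔ ∀ x ∈ U, ∃ d : ℤ, d ≠ 0 ∧ IsCoprime d x.val ∧ residueClass x.val d ⊆ U := by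
  constructor
  · intro hU
    induction hU with
    | basic s hs =>
      obtain ⟨a, I, hI, haI, rfl⟩ := hs
      rintro x ⟨i, hi, hx⟩
      obtain ⟨g, rfl⟩ : ∃ g : ℤ, I = Ideal.span {g} :=
        ⟨_, (Submodule.IsPrincipal.span_singleton_generator I).symm⟩
      have hag : IsCoprime a g := by
        rw [← Ideal.isCoprime_span_singleton_iff, Ideal.isCoprime_iff_sup_eq]; exact haI
      obtain ⟨c, rfl⟩ := Ideal.mem_span_singleton.1 hi
      refine ⟨g, by simpa using hI, ?_, ?_⟩
      · rw [hx]; exact (IsCoprime.add_mul_left_left hag c).symm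
      · rintro y ⟨k, hk⟩
        exact ⟨g * (c + k), Ideal.mem_span_singleton.2 ⟨_, rfl⟩, by linear_combination hk + hx⟩
    | univ => exact fun x _ => ⟨1, one_ne_zero, isCoprime_one_left, fun _ _ => trivial⟩
    | inter s t _ _ hs ht =>
      rintro x ⟨hxs, hxt⟩
      obtain ⟨d, hd, hdx, hds⟩ := hs x hxs
      obtain ⟨d', hd', hdx', hdt⟩ := ht x hxt
      exact ⟨d * d', mul_ne_zero hd hd', hdx.mul_left hdx', fun y hy =>
        ⟨hds ((dvd_mul_right d d').trans hy), hdt ((dvd_mul_left d' d).trans hy)⟩⟩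
    | sUnion S _ ih =>
      rintro x ⟨s, hs, hxs⟩
      obtain ⟨d, hd, hdx, hds⟩ := ih s hs x hxs
      exact ⟨d, hd, hdx, hds.trans (Set.subset_sUnion_of_mem hs)⟩
  · intro h
    rw [isOpen_iff_forall_mem_open]
    intro x hx
    obtain ⟨d, hd, hdx, hdU⟩ := h x hx
    refine ⟨coset x.val (Ideal.span {d}), ?_, ?_, 0, zero_mem _, by simp⟩
    · rintro y ⟨i, hi, hy⟩
      obtain ⟨c, rfl⟩ := Ideal.mem_span_singleton.1 hi
      exact hdU ⟨c, by linear_combination hy⟩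
    · refine TopologicalSpace.isOpen_generateFrom_of_mem ⟨_, _, by simpa using hd, ?_, rfl⟩
      rw [← Ideal.isCoprime_iff_sup_eq, Ideal.isCoprime_span_singleton_iff]
      exact hdx.symm

theorem mem_residueClass_self (x : GolombSpace ℤ) (d : ℤ) : x ∈ residueClass x.val d := by
  simp [residueClass]

theorem isOpen_residueClass {a d : ℤ} (hd : d ≠ 0) (had : IsCoprime a d) :
    IsOpen (residueClass a d) := by
  rw [isOpen_iff]
  rintro x ⟨c, hc⟩
  refine ⟨d, hd, ?_, ?_⟩
  · rw [show x.val = a + d * c by linear_combination hc]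
    exact (had.add_mul_left_left c).symm
  · intro y hy
    simpa [residueClass] using dvd_add hy (Dvd.intro c hc.symm)

theorem mem_nhds_iff' {x : GolombSpace ℤ} {U : Set (GolombSpace ℤ)} :
    U ∈ 𝓝 x ↔ ∃ d : ℤ, d ≠ 0 ∧ IsCoprime d x.val ∧ residueClass x.val d ⊆ U := by
  constructor
  · intro h
    obtain ⟨V, hVU, hV, hxV⟩ := mem_nhds_iff.1 h
    obtain ⟨d, hd, hdx, hdV⟩ := isOpen_iff.1 hV x hxV
    exact ⟨d, hd, hdx, hdV.trans hVU⟩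
  · rintro ⟨d, hd, hdx, hdU⟩
    exact mem_of_superset ((isOpen_residueClass hd hdx.symm).mem_nhds (mem_residueClass_self x d))
      hdU

theorem isCoprime_of_forall_prime {a b : ℤ}
    (h : ∀ p : ℕ, p.Prime → (p : ℤ) ∣ a → ¬ (p : ℤ) ∣ b) : IsCoprime a b := by
  rw [Int.isCoprime_iff_gcd_eq_one]
  by_contra hg
  obtain ⟨p, hp, hpg⟩ := Nat.exists_prime_and_dvd hg
  exact h p hp ((Int.natCast_dvd_natCast.2 hpg).trans (Int.gcd_dvd_left ..))
    ((Int.natCast_dvd_natCast.2 hpg).trans (Int.gcd_dvd_right ..))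

theorem IsCoprime.not_dvd_of_prime {a b : ℤ} (h : IsCoprime a b) {p : ℕ} (hp : p.Prime)
    (ha : (p : ℤ) ∣ a) : ¬ (p : ℤ) ∣ b := fun hb =>
  (Nat.prime_iff_prime_int.1 hp).not_isUnit (h.isUnit_of_dvd' ha hb)

theorem isCoprime_pow_of_not_dvd {p : ℕ} (hp : p.Prime) {x : ℤ} (hx : ¬ (p : ℤ) ∣ x) (k : ℕ) :
    IsCoprime ((p : ℤ) ^ k) x :=
  (((Nat.prime_iff_prime_int.1 hp).coprime_iff_not_dvd).2 hx).pow_left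

/-- A point of the closure of `x + dℤ`: modulo one factor of `d` it agrees with `x`, and it is
divisible by all primes of the other factor. -/
theorem mem_closure_residueClass {x d₁ d₂ : ℤ} {z : GolombSpace ℤ} (hd : d₁ * d₂ ≠ 0)
    (h₁ : d₁ ∣ z.val - x) (h₂ : ∀ p : ℕ, p.Prime → (p : ℤ) ∣ d₂ → (p : ℤ) ∣ z.val) :
    z ∈ closure (residueClass x (d₁ * d₂)) := by
  rw [mem_closure_iff_nhds]
  intro U hU
  obtain ⟨c, hc, hcz, hcU⟩ := mem_nhds_iff'.1 hU
  have hcd : IsCoprime c d₂ := isCoprime_of_forall_prime fun p hp hpc hpd =>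
    IsCoprime.not_dvd_of_prime hcz hp hpc (h₂ p hp hpd)
  -- Bézout for c and d₂ yields w congruent to z modulo c and to x modulo d₁d₂.
  obtain ⟨k, hk⟩ := h₁
  obtain ⟨a, b, hab⟩ := hcd
  obtain ⟨w, hw⟩ := exists_val_of_dvd (z.val - c * (a * d₁ * k)) (c * (d₁ * d₂))
    (mul_ne_zero hc hd)
  obtain ⟨l, hl⟩ := hw
  refine ⟨w, hcU ⟨d₁ * d₂ * l - a * d₁ * k, by linear_combination hl⟩, ⟨c * l + b * k, ?_⟩⟩
  linear_combination hl + hk - d₁ * k * hab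

theorem pow_dvd_sub_of_mem_closure {p : ℕ} (hp : p.Prime) {x : ℤ} {z : GolombSpace ℤ} {k : ℕ}
    (hz : z ∈ closure (residueClass x ((p : ℤ) ^ k))) (hpz : ¬ (p : ℤ) ∣ z.val) :
    (p : ℤ) ^ k ∣ z.val - x := by
  rw [mem_closure_iff_nhds] at hz
  obtain ⟨w, hw₁, hw₂⟩ := hz (residueClass z.val ((p : ℤ) ^ k))
    (mem_nhds_iff'.2 ⟨_, pow_ne_zero _ (by exact_mod_cast hp.ne_zero),
      isCoprime_pow_of_not_dvd hp hpz k, subset_rfl⟩)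
  have := dvd_sub hw₂ hw₁
  simpa using this

/-! ### Closed neighbourhoods and prime divisors -/

/-- The filter generated by the intersections of closed neighbourhoods of `x` and of `y`. -/
def closureFilter {X : Type*} [TopologicalSpace X] (x y : X) : Filter X :=
  (𝓝 x).lift' closure ⊓ (𝓝 y).lift' closure

theorem map_closureFilter {X Y : Type*} [TopologicalSpace X] [TopologicalSpace Y] (h : X ≃ₜ Y)
    (x y : X) : map h (closureFilter x y) = closureFilter (h x) (h y) := by
  have key : ∀ x : X, map h ((𝓝 x).lift' closure) = (𝓝 (h x)).lift' closure := by
    intro x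
    rw [← h.map_nhds_eq, map_lift'_eq (monotone_closure X), map_lift'_eq2 (monotone_closure Y)]
    congr 1
    ext s : 1
    simp [Function.comp, h.image_closure]
  rw [closureFilter, Filter.map_inf h.injective, key, key, closureFilter]

theorem closureFilter_le_iff {X Y : Type*} [TopologicalSpace X] [TopologicalSpace Y] (h : X ≃ₜ Y)
    (x y x' y' : X) : closureFilter (h x) (h y) ≤ closureFilter (h x') (h y') ↔
      closureFilter x y ≤ closureFilter x' y' := by
  rw [← map_closureFilter, ← map_closureFilter, Filter.map_le_map_iff h.injective]

theorem mem_closureFilter {X : Type*} [TopologicalSpace X] {x y : X} {A : Set X} :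
    A ∈ closureFilter x y ↔ ∃ U ∈ 𝓝 x, ∃ V ∈ 𝓝 y, closure U ∩ closure V ⊆ A := by
  have hb := ((𝓝 x).basis_sets.lift'_closure).inf ((𝓝 y).basis_sets.lift'_closure)
  rw [closureFilter, hb.mem_iff]
  simp [and_assoc]

/-- For p^(k+1) not dividing x - y, a point prime to p in the closures of both classes modulo
p^(k+1) would be congruent to x and to y. -/
theorem multiples_mem_closureFilter {x y : GolombSpace ℤ} (hxy : x ≠ y) {p : ℕ} (hp : p.Prime)
    (hx : ¬ (p : ℤ) ∣ x.val) (hy : ¬ (p : ℤ) ∣ y.val) :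
    {z : GolombSpace ℤ | (p : ℤ) ∣ z.val} ∈ closureFilter x y := by
  have hne : x.val - y.val ≠ 0 := fun h => hxy (GolombSpace.ext (sub_eq_zero.1 h))
  obtain ⟨k, hk⟩ := (FiniteMultiplicity.of_prime_left (Nat.prime_iff_prime_int.1 hp) hne)
  have hp0 : (p : ℤ) ^ (k + 1) ≠ 0 := pow_ne_zero _ (by exact_mod_cast hp.ne_zero)
  refine mem_closureFilter.2 ⟨residueClass x.val ((p : ℤ) ^ (k + 1)), mem_nhds_iff'.2
    ⟨_, hp0, isCoprime_pow_of_not_dvd hp hx _, subset_rfl⟩,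
    residueClass y.val ((p : ℤ) ^ (k + 1)), mem_nhds_iff'.2
    ⟨_, hp0, isCoprime_pow_of_not_dvd hp hy _, subset_rfl⟩, ?_⟩
  rintro z ⟨hzx, hzy⟩
  by_contra hz
  apply hk
  have := dvd_sub (pow_dvd_sub_of_mem_closure hp hzy hz) (pow_dvd_sub_of_mem_closure hp hzx hz)
  simpa using this

theorem common_multiples_mem_closureFilter {x y : GolombSpace ℤ} (hxy : x ≠ y) {N : ℤ}
    (hN : N ≠ 0) (hx : IsCoprime N x.val) (hy : IsCoprime N y.val) :
    {z : GolombSpace ℤ | ∀ p : ℕ, p.Prime → (p : ℤ) ∣ N → (p : ℤ) ∣ z.val} ∈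
      closureFilter x y := by
  have : (⋂ p ∈ N.natAbs.primeFactors, {z : GolombSpace ℤ | (p : ℤ) ∣ z.val}) ∈
      closureFilter x y := by
    rw [Filter.biInter_finset_mem]
    intro p hp
    have hp' := Nat.prime_of_mem_primeFactors hp
    have hpN : (p : ℤ) ∣ N := Int.natCast_dvd.2 (Nat.dvd_of_mem_primeFactors hp)
    exact multiples_mem_closureFilter hxy hp' (IsCoprime.not_dvd_of_prime hx hp' hpN)
      (IsCoprime.not_dvd_of_prime hy hp' hpN)
  refine mem_of_superset this fun z hz p hp hpN => ?_
  simp only [Set.mem_iInter] at hz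
  exact hz p (Nat.mem_primeFactors.2 ⟨hp, Int.natCast_dvd.1 hpN, by simpa using hN⟩)

theorem exists_eq_pow_mul {p : ℕ} (hp : p.Prime) {d : ℤ} (hd : d ≠ 0) :
    ∃ (j : ℕ) (N : ℤ), d = (p : ℤ) ^ j * N ∧ ¬ (p : ℤ) ∣ N ∧ N ≠ 0 := by
  obtain ⟨N, h, hN⟩ := (FiniteMultiplicity.of_prime_left
    (Nat.prime_iff_prime_int.1 hp) hd).exists_eq_pow_mul_and_not_dvd
  exact ⟨_, N, h, hN, fun h0 => hN (by simp [h0])⟩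

/-- The Chinese remainder theorem on nonzero integers. -/
theorem exists_congr_dvd {p : ℕ} (hp : p.Prime) {N : ℤ} (hN : ¬ (p : ℤ) ∣ N) (c : ℤ) (k : ℕ) :
    ∃ z : GolombSpace ℤ, (p : ℤ) ^ k ∣ z.val - c ∧ N ∣ z.val := by
  have hN0 : N ≠ 0 := fun h0 => hN (by simp [h0])
  obtain ⟨a, b, hab⟩ := isCoprime_pow_of_not_dvd hp hN k
  obtain ⟨z, l, hl⟩ := exists_val_of_dvd (b * N * c) ((p : ℤ) ^ k * N)
    (mul_ne_zero (pow_ne_zero _ (by exact_mod_cast hp.ne_zero)) hN0)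
  exact ⟨z, ⟨N * l - a * c, by linear_combination hl + c * hab⟩,
    ⟨(p : ℤ) ^ k * l + b * c, by linear_combination hl⟩⟩

theorem closureFilter_comm {X : Type*} [TopologicalSpace X] (x y : X) :
    closureFilter x y = closureFilter y x := inf_comm _ _

/-- Neighbourhoods of x impose no condition at p, and one of y fixes at most a residue that can be
taken prime to p. So any two closed neighbourhoods share a point prime to p. -/
theorem multiples_notMem_closureFilter {x : GolombSpace ℤ} (y : GolombSpace ℤ) {p : ℕ}
    (hp : p.Prime) (hx : (p : ℤ) ∣ x.val) :
    {z : GolombSpace ℤ | (p : ℤ) ∣ z.val} ∉ closureFilter x y := by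
  intro hmem
  obtain ⟨U, hU, V, hV, hUV⟩ := mem_closureFilter.1 hmem
  obtain ⟨d, hd, hdx, hdU⟩ := mem_nhds_iff'.1 hU
  obtain ⟨d', hd', hdy, hdV⟩ := mem_nhds_iff'.1 hV
  obtain ⟨j, N, rfl, hN, hN0⟩ := exists_eq_pow_mul hp hd'
  have hpd : ¬ (p : ℤ) ∣ d := IsCoprime.not_dvd_of_prime hdx.symm hp hx
  have hpp := Nat.prime_iff_prime_int.1 hp
  have hpdN : ¬ (p : ℤ) ∣ d * N := fun h => (hpp.dvd_or_dvd h).elim hpd hN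
  obtain ⟨c, hpc, hc⟩ : ∃ c : ℤ, ¬ (p : ℤ) ∣ c ∧ (p : ℤ) ^ j ∣ c - y.val := by
    by_cases hy : (p : ℤ) ∣ y.val
    · refine ⟨1, hpp.not_dvd_one, ?_⟩
      rcases j with _ | j
      · simp
      · exact absurd hy (IsCoprime.not_dvd_of_prime hdy hp
          ((dvd_pow_self _ j.succ_ne_zero).mul_right _))
    · exact ⟨_, hy, by simp⟩
  -- The exponent j + 1 makes z prime to p even when j = 0.
  obtain ⟨z, hz, hdz⟩ := exists_congr_dvd hp hpdN c (j + 1)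
  have hpz : ¬ (p : ℤ) ∣ z.val := fun h =>
    hpc ((dvd_iff_dvd_of_dvd_sub ((dvd_pow_self _ j.succ_ne_zero).trans hz)).1 h)
  refine hpz (hUV ⟨closure_mono hdU ?_, closure_mono hdV ?_⟩)
  · rw [← one_mul d]
    exact mem_closure_residueClass (by simpa using hd) (one_dvd _) fun q _ hq =>
      hq.trans ((dvd_mul_right d N).trans hdz)
  · refine mem_closure_residueClass hd' ?_ fun q _ hq =>
      hq.trans ((dvd_mul_left N d).trans hdz)
    have := dvd_add ((pow_dvd_pow (p : ℤ) j.le_succ).trans hz) hc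
    simpa using this

/-! ### Units, sets of prime divisors, and the permutation of the primes -/

theorem isUnit_of_forall_prime_not_dvd {x : ℤ} (h : ∀ p : ℕ, p.Prime → ¬ (p : ℤ) ∣ x) :
    IsUnit x := by
  rw [Int.isUnit_iff_natAbs_eq]
  by_contra hx
  obtain ⟨p, hp, hpx⟩ := Nat.exists_prime_and_dvd hx
  exact h p hp (Int.natCast_dvd.2 hpx)

theorem not_prime_dvd_of_isUnit {x : ℤ} (h : IsUnit x) {p : ℕ} (hp : p.Prime) :
    ¬ (p : ℤ) ∣ x := fun hpx =>
  (Nat.prime_iff_prime_int.1 hp).not_isUnit (isUnit_of_dvd_unit hpx h)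

/-- A neighbourhood of x has a modulus d prime to x, hence prime to y. The filter thus contains the
set of common multiples of the primes of d, and these all lie in the closure of x + dℤ. -/
theorem closureFilter_le_lift'_closure {u x y : GolombSpace ℤ} (hu : IsUnit u.val) (hy : y ≠ u)
    (h : ∀ p : ℕ, p.Prime → (p : ℤ) ∣ y.val → (p : ℤ) ∣ x.val) :
    closureFilter u y ≤ (𝓝 x).lift' closure := by
  intro A hA
  obtain ⟨U, hU, hUA⟩ := ((𝓝 x).basis_sets.lift'_closure).mem_iff.1 hA
  obtain ⟨d, hd, hdx, hdU⟩ := mem_nhds_iff'.1 hU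
  refine mem_of_superset (common_multiples_mem_closureFilter hy.symm hd
    (isCoprime_of_forall_prime fun p hp _ => not_prime_dvd_of_isUnit hu hp)
    (isCoprime_of_forall_prime fun p hp hpd hpy =>
      IsCoprime.not_dvd_of_prime hdx hp hpd (h p hp hpy))) fun z hz => hUA (closure_mono hdU ?_)
  rw [← one_mul d]
  exact mem_closure_residueClass (by simpa using hd) (one_dvd _) hz

theorem closureFilter_le_closureFilter_iff {u x y : GolombSpace ℤ} (hu : IsUnit u.val)
    (hx : x ≠ u) (hy : y ≠ u) :
    closureFilter u y ≤ closureFilter u x ↔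
      ∀ p : ℕ, p.Prime → (p : ℤ) ∣ y.val → (p : ℤ) ∣ x.val := by
  constructor
  · intro h p hp hpy
    by_contra hpx
    have := h (multiples_mem_closureFilter hx.symm hp (not_prime_dvd_of_isUnit hu hp) hpx)
    rw [closureFilter_comm] at this
    exact multiples_notMem_closureFilter u hp hpy this
  · exact fun h => le_inf inf_le_left (closureFilter_le_lift'_closure hu hy h)

/-- The filter of the pair u, -u is the least of all `closureFilter x y`, and leastness passes to
the images. A prime dividing h(u) would contradict it. -/
theorem isUnit_apply_of_isUnit (h : GolombSpace ℤ ≃ₜ GolombSpace ℤ) {u : GolombSpace ℤ}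
    (hu : IsUnit u.val) : IsUnit (h u).val := by
  have hne : u.val ≠ -u.val := fun h0 => u.ne_zero (by lia)
  let v : GolombSpace ℤ := ⟨-u.val, neg_ne_zero.2 u.ne_zero⟩
  have hv : IsUnit v.val := hu.neg
  have huv : v ≠ u := fun h0 => hne (congrArg val h0).symm
  have hmin : ∀ x y : GolombSpace ℤ, closureFilter u v ≤ closureFilter x y := fun x y =>
    le_inf (closureFilter_le_lift'_closure hu huv fun p hp hpv => absurd hpv (not_prime_dvd_of_isUnit hv hp))
      (closureFilter_le_lift'_closure hu huv fun p hp hpv => absurd hpv (not_prime_dvd_of_isUnit hv hp))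
  refine isUnit_of_forall_prime_not_dvd fun p hp hpu => ?_
  have hle := (closureFilter_le_iff h u v (h.symm u) (h.symm v)).2 (hmin _ _)
  rw [h.apply_symm_apply, h.apply_symm_apply] at hle
  exact multiples_notMem_closureFilter (h v) hp hpu (hle (multiples_mem_closureFilter huv.symm hp
    (not_prime_dvd_of_isUnit hu hp) (not_prime_dvd_of_isUnit hv hp)))

theorem isUnit_apply_iff (h : GolombSpace ℤ ≃ₜ GolombSpace ℤ) {u : GolombSpace ℤ} :
    IsUnit (h u).val ↔ IsUnit u.val :=
  ⟨fun hu => by simpa using isUnit_apply_of_isUnit h.symm hu, isUnit_apply_of_isUnit h⟩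

theorem forall_prime_dvd_apply_iff (h : GolombSpace ℤ ≃ₜ GolombSpace ℤ) {x y : GolombSpace ℤ}
    (hx : ¬ IsUnit x.val) (hy : ¬ IsUnit y.val) :
    (∀ p : ℕ, p.Prime → (p : ℤ) ∣ (h y).val → (p : ℤ) ∣ (h x).val) ↔
      ∀ p : ℕ, p.Prime → (p : ℤ) ∣ y.val → (p : ℤ) ∣ x.val := by
  let u : GolombSpace ℤ := ⟨1, one_ne_zero⟩
  have hu : IsUnit u.val := isUnit_one
  have hxu : x ≠ u := by rintro rfl; exact hx hu
  have hyu : y ≠ u := by rintro rfl; exact hy hu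
  rw [← closureFilter_le_closureFilter_iff hu hxu hyu,
    ← closureFilter_le_closureFilter_iff (isUnit_apply_of_isUnit h hu)
      (h.injective.ne hxu) (h.injective.ne hyu), closureFilter_le_iff]

/-- The homeomorphism `h` maps the multiples of `p` onto the multiples of `q`. -/
def MapsMultiples (h : GolombSpace ℤ ≃ₜ GolombSpace ℤ) (p q : ℕ) : Prop :=
  ∀ x : GolombSpace ℤ, (p : ℤ) ∣ x.val ↔ (q : ℤ) ∣ (h x).val

theorem MapsMultiples.symm {h : GolombSpace ℤ ≃ₜ GolombSpace ℤ} {p q : ℕ}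
    (H : MapsMultiples h p q) : MapsMultiples h.symm q p := fun x => by
  rw [H, h.apply_symm_apply]

theorem eq_of_prime_natCast_dvd {p q : ℕ} (hp : p.Prime) (hq : q.Prime) (h : (p : ℤ) ∣ (q : ℤ)) :
    p = q := (Nat.prime_dvd_prime_iff_eq hp hq).1 (Int.natCast_dvd_natCast.1 h)

/-- Primes correspond to the minimal nonempty sets of prime divisors, and h preserves the inclusion
order on these sets. -/
theorem exists_mapsMultiples (h : GolombSpace ℤ ≃ₜ GolombSpace ℤ) {p : ℕ} (hp : p.Prime) :
    ∃ q : ℕ, q.Prime ∧ MapsMultiples h p q := by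
  have hunit : ∀ {p : ℕ}, p.Prime → ∀ {x : ℤ}, (p : ℤ) ∣ x → ¬ IsUnit x :=
    fun hp _ hx hu => not_prime_dvd_of_isUnit hu hp hx
  let P : GolombSpace ℤ := ⟨p, by exact_mod_cast hp.ne_zero⟩
  have hP : ¬ IsUnit P.val := hunit hp dvd_rfl
  have hhP : ¬ IsUnit (h P).val := (isUnit_apply_iff h).not.2 hP
  obtain ⟨q, hq, hqP⟩ : ∃ q : ℕ, q.Prime ∧ (q : ℤ) ∣ (h P).val := by
    by_contra! hno
    exact hhP (isUnit_of_forall_prime_not_dvd hno)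
  obtain ⟨Y, hY⟩ := h.surjective ⟨q, by exact_mod_cast hq.ne_zero⟩
  have hYv : (h Y).val = q := by rw [hY]
  have hYu : ¬ IsUnit Y.val := (isUnit_apply_iff h).not.1 (hunit hq (by rw [hYv]))
  have h1 := (forall_prime_dvd_apply_iff h hP hYu).1 fun l hl hlq => by
    rw [hYv] at hlq
    rwa [eq_of_prime_natCast_dvd hl hq hlq]
  have hpY : (p : ℤ) ∣ Y.val := by
    by_contra hpY
    refine hYu (isUnit_of_forall_prime_not_dvd fun l hl hlY => hpY ?_)
    rwa [← eq_of_prime_natCast_dvd hl hp (h1 l hl hlY)]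
  have h2 := (forall_prime_dvd_apply_iff h hYu hP).2 fun l hl hlp => by
    rwa [eq_of_prime_natCast_dvd hl hp hlp]
  refine ⟨q, hq, fun x => ⟨fun hx => ?_, fun hx => ?_⟩⟩
  · exact (forall_prime_dvd_apply_iff h (hunit hp hx) hP).2 (fun l hl hlp => by
      rwa [eq_of_prime_natCast_dvd hl hp hlp]) q hq hqP
  · refine (forall_prime_dvd_apply_iff h ((isUnit_apply_iff h).not.1 (hunit hq hx)) hP).1
      (fun l hl hlP => ?_) p hp dvd_rfl
    have := h2 l hl hlP
    rw [hYv] at this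
    rwa [eq_of_prime_natCast_dvd hl hq this]

theorem MapsMultiples.left_unique {h : GolombSpace ℤ ≃ₜ GolombSpace ℤ} {p p' q : ℕ}
    (hp : p.Prime) (hp' : p'.Prime) (H : MapsMultiples h p q) (H' : MapsMultiples h p' q) :
    p = p' :=
  (eq_of_prime_natCast_dvd hp' hp ((H' ⟨p, by exact_mod_cast hp.ne_zero⟩).2
    ((H ⟨p, by exact_mod_cast hp.ne_zero⟩).1 dvd_rfl))).symm

theorem MapsMultiples.right_unique {h : GolombSpace ℤ ≃ₜ GolombSpace ℤ} {p q q' : ℕ}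
    (hq : q.Prime) (hq' : q'.Prime) (H : MapsMultiples h p q) (H' : MapsMultiples h p q') :
    q = q' := H.symm.left_unique hq hq' H'.symm

/-! ### Continuity of h for the p-adic topologies -/

/-- If the integers prime to `q` are split into two open sets, then these are `q`-adically open. -/
theorem exists_pow_dvd_sub_imp_mem {q : ℕ} (hq : q.Prime) {W W' : Set (GolombSpace ℤ)}
    (hW : IsOpen W) (hW' : IsOpen W') (hd : Disjoint W W')
    (hcov : ∀ x : GolombSpace ℤ, ¬ (q : ℤ) ∣ x.val → x ∈ W ∨ x ∈ W')
    {x : GolombSpace ℤ} (hx : x ∈ W) (hqx : ¬ (q : ℤ) ∣ x.val) :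
    ∃ j : ℕ, ∀ y : GolombSpace ℤ, (q : ℤ) ^ j ∣ y.val - x.val → y ∈ W := by
  obtain ⟨d, hd0, hdx, hdW⟩ := isOpen_iff.1 hW x hx
  obtain ⟨j, N, rfl, hN, hN0⟩ := exists_eq_pow_mul hq hd0
  refine ⟨j + 1, fun y hy => ?_⟩
  have hqj : (q : ℤ) ∣ (q : ℤ) ^ (j + 1) := dvd_pow_self _ j.succ_ne_zero
  have hqy : ¬ (q : ℤ) ∣ y.val := (dvd_iff_dvd_of_dvd_sub (hqj.trans hy)).not.2 hqx
  refine (hcov y hqy).resolve_right fun hyW => ?_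
  obtain ⟨d', hd0', hdy, hdW'⟩ := isOpen_iff.1 hW' y hyW
  obtain ⟨j', N', rfl, hN', hN0'⟩ := exists_eq_pow_mul hq hd0'
  have hNN : ¬ (q : ℤ) ∣ N * N' := fun h =>
    ((Nat.prime_iff_prime_int.1 hq).dvd_or_dvd h).elim hN hN'
  -- This w is prime to q and lies in the closures of both W and W', although one of these disjoint
  -- open sets contains it.
  obtain ⟨w, hw, hNw⟩ := exists_congr_dvd hq hNN y.val (j' + (j + 1))
  have hwj := (pow_dvd_pow (q : ℤ) (Nat.le_add_left (j + 1) j')).trans hw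
  have hqw : ¬ (q : ℤ) ∣ w.val := (dvd_iff_dvd_of_dvd_sub (hqj.trans hwj)).not.2 hqy
  have hwx : (q : ℤ) ^ j ∣ w.val - x.val := by
    have := (pow_dvd_pow (q : ℤ) j.le_succ).trans (dvd_add hwj hy)
    simpa using this
  have h1 : w ∈ closure W := closure_mono hdW <| mem_closure_residueClass hd0 hwx
    fun p _ hp => hp.trans ((dvd_mul_right N N').trans hNw)
  have h2 : w ∈ closure W' := closure_mono hdW' <| mem_closure_residueClass hd0'
    ((pow_dvd_pow (q : ℤ) (Nat.le_add_right j' (j + 1))).trans hw)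
    fun p _ hp => hp.trans ((dvd_mul_left N' N).trans hNw)
  rcases hcov w hqw with hwW | hwW
  · exact (hd.closure_right hW).le_bot ⟨hwW, h2⟩
  · exact (hd.closure_left hW').le_bot ⟨h1, hwW⟩

/-- Away from the multiples of `p`, the homeomorphism `h` is continuous for the `p`-adic and the
`q`-adic topology. -/
theorem MapsMultiples.exists_pow_dvd_sub {h : GolombSpace ℤ ≃ₜ GolombSpace ℤ} {p q : ℕ}
    (hp : p.Prime) (hq : q.Prime) (H : MapsMultiples h p q) {x : GolombSpace ℤ}
    (hx : ¬ (p : ℤ) ∣ x.val) (k : ℕ) :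
    ∃ j : ℕ, ∀ y : GolombSpace ℤ, (p : ℤ) ^ j ∣ y.val - x.val →
      (q : ℤ) ^ k ∣ (h y).val - (h x).val := by
  have hqk : (q : ℤ) ^ k ≠ 0 := pow_ne_zero _ (by exact_mod_cast hq.ne_zero)
  refine exists_pow_dvd_sub_imp_mem (q := p) hp
    (W := h ⁻¹' residueClass (h x).val ((q : ℤ) ^ k))
    (W' := h ⁻¹' {y | ¬ (q : ℤ) ∣ y.val ∧ y ∉ residueClass (h x).val ((q : ℤ) ^ k)})
    ((isOpen_residueClass hqk (isCoprime_pow_of_not_dvd hq ((H x).not.1 hx) k).symm).preimage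
      h.continuous) (IsOpen.preimage h.continuous ?_) ?_ ?_
    (mem_residueClass_self (h x) _) hx
  · rw [isOpen_iff]
    rintro y ⟨hqy, hyx⟩
    -- The exponent k + 1 keeps q a divisor of the modulus when k = 0.
    refine ⟨(q : ℤ) ^ (k + 1), pow_ne_zero _ (by exact_mod_cast hq.ne_zero),
      isCoprime_pow_of_not_dvd hq hqy _, fun z hz => ⟨fun hqz => hqy ?_, fun hzx => hyx ?_⟩⟩
    · exact (dvd_iff_dvd_of_dvd_sub ((dvd_pow_self _ k.succ_ne_zero).trans hz)).1 hqz
    · have := dvd_sub hzx ((pow_dvd_pow (q : ℤ) k.le_succ).trans hz)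
      simpa [residueClass] using this
  · rw [Set.disjoint_left]
    exact fun y hy hy' => hy'.2 hy
  · exact fun y hy => or_iff_not_imp_left.2 fun hyW => ⟨(H y).not.1 hy, hyW⟩

end GolombSpace

/-! ### Adherence to powers, and lifting the exponent -/

/-- `a` is `p`-adically adherent to the set of all `± r ^ m`, `m ≥ 0`. -/
def PowAdherent (p : ℕ) (r a : ℤ) : Prop :=
  ∀ k : ℕ, ∃ (σ : ℤˣ) (m : ℕ), a ≡ σ * r ^ m [ZMOD (p : ℤ) ^ k]

theorem PowAdherent.trans {p : ℕ} {r a b : ℤ} (h₁ : PowAdherent p r a) (h₂ : PowAdherent p a b) :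
    PowAdherent p r b := fun k => by
  obtain ⟨σ, m, hb⟩ := h₂ k
  obtain ⟨τ, l, ha⟩ := h₁ k
  refine ⟨σ * τ ^ m, l * m, hb.trans ?_⟩
  have := (ha.pow m).mul_left (σ : ℤ)
  rw [mul_pow, ← pow_mul, ← mul_assoc] at this
  push_cast
  exact this

theorem powAdherent_unit_mul_pow (p : ℕ) (r : ℤ) (σ : ℤˣ) (m : ℕ) :
    PowAdherent p r (σ * r ^ m) := fun _ => ⟨σ, m, rfl⟩

theorem PowAdherent.not_dvd {p : ℕ} (hp : p.Prime) {r a : ℤ} (h : PowAdherent p r a)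
    (hr : ¬ (p : ℤ) ∣ r) : ¬ (p : ℤ) ∣ a := by
  obtain ⟨σ, m, hm⟩ := h 1
  rw [pow_one] at hm
  rw [hm.dvd_iff, Units.dvd_mul_left]
  exact fun h => hr ((Nat.prime_iff_prime_int.1 hp).dvd_of_dvd_pow h)

theorem sq_dvd_one_add_pow_sub (T : ℤ) (j : ℕ) : T ^ 2 ∣ (1 + T) ^ j - (1 + j * T) := by
  induction j with
  | zero => simp
  | succ j ih =>
    obtain ⟨c, hc⟩ := ih
    exact ⟨c * (1 + T) + j, by push_cast; rw [pow_succ]; linear_combination (1 + T) * hc⟩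

section Lifting

variable {p f : ℕ} {g : ℤ}

/-- The case p = 2, f = 1 must be excluded: 3 - 1 = 2 but 3² - 1 = 8. -/
theorem exact_dvd_pow_sub_one (hp : p.Prime) (hf : 1 ≤ f) (hf2 : p = 2 → 2 ≤ f)
    (h₁ : (p : ℤ) ^ f ∣ g - 1) (h₂ : ¬ (p : ℤ) ^ (f + 1) ∣ g - 1) :
    (p : ℤ) ^ (f + 1) ∣ g ^ p - 1 ∧ ¬ (p : ℤ) ^ (f + 1 + 1) ∣ g ^ p - 1 := by
  have hpg : (p : ℤ) ∣ g - 1 := (dvd_pow_self _ (by lia)).trans h₁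
  rcases hp.eq_two_or_odd' with rfl | hodd
  · obtain ⟨f, rfl⟩ := Nat.exists_eq_add_of_le' (hf2 rfl)
    obtain ⟨c, hc⟩ := h₁
    push_cast at *
    have hg : g ^ 2 - 1 = 2 ^ (f + 2 + 1) * (c * (1 + 2 * (2 ^ f * c))) := by
      rw [show g = 1 + 2 ^ (f + 2) * c by linear_combination hc]; ring
    rw [hg, pow_succ _ (f + 2 + 1), mul_dvd_mul_iff_left (by positivity)]
    refine ⟨dvd_mul_right _ _, fun h => h₂ ?_⟩
    rw [hc, pow_succ, mul_dvd_mul_iff_left (by positivity)]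
    rcases Int.prime_two.dvd_or_dvd h with h | h
    · exact h
    · exact absurd h (by lia)
  · have hpg' : ¬ (p : ℤ) ∣ g := fun h =>
      (Nat.prime_iff_prime_int.1 hp).not_dvd_one (by simpa using dvd_sub h hpg)
    have h := Int.emultiplicity_pow_sub_pow hp hodd hpg hpg' p
    rw [emultiplicity_eq_coe.2 ⟨h₁, h₂⟩, one_pow,
      (Nat.finiteMultiplicity_iff.2 ⟨hp.ne_one, hp.pos⟩).emultiplicity_self] at h
    exact emultiplicity_eq_coe.1 (by exact_mod_cast h)

theorem exact_dvd_pow_prime_pow_sub_one (hp : p.Prime) (hf : 1 ≤ f) (hf2 : p = 2 → 2 ≤ f)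
    (h₁ : (p : ℤ) ^ f ∣ g - 1) (h₂ : ¬ (p : ℤ) ^ (f + 1) ∣ g - 1) (i : ℕ) :
    (p : ℤ) ^ (f + i) ∣ g ^ p ^ i - 1 ∧ ¬ (p : ℤ) ^ (f + i + 1) ∣ g ^ p ^ i - 1 := by
  induction i with
  | zero => simpa using ⟨h₁, h₂⟩
  | succ i ih =>
    rw [pow_succ p i, pow_mul, ← add_assoc]
    exact exact_dvd_pow_sub_one hp (by lia) (fun h => (hf2 h).trans (Nat.le_add_right _ _))
      ih.1 ih.2

theorem not_dvd_pow_of_dvd_sub_one (hp : p.Prime) (h : (p : ℤ) ∣ g - 1) (m : ℕ) :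
    ¬ (p : ℤ) ∣ g ^ m := fun hg => (Nat.prime_iff_prime_int.1 hp).not_dvd_one <| by
  simpa using dvd_sub ((Nat.prime_iff_prime_int.1 hp).dvd_of_dvd_pow hg) h

/-- If `p ^ f` exactly divides `g - 1`, then the powers of `g` are `p`-adically dense in
`1 + p ^ f ℤ`. -/
theorem exists_modEq_mul_pow (hp : p.Prime) (hf : 1 ≤ f) (hf2 : p = 2 → 2 ≤ f)
    (h₁ : (p : ℤ) ^ f ∣ g - 1) (h₂ : ¬ (p : ℤ) ^ (f + 1) ∣ g - 1) {w a : ℤ}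
    (hw : ¬ (p : ℤ) ∣ w) (ha : a ≡ w [ZMOD (p : ℤ) ^ f]) (k : ℕ) :
    ∃ m : ℕ, a ≡ w * g ^ m [ZMOD (p : ℤ) ^ k] := by
  suffices h : ∀ i : ℕ, ∃ m : ℕ, a ≡ w * g ^ m [ZMOD (p : ℤ) ^ (f + i)] by
    obtain ⟨m, hm⟩ := h k
    exact ⟨m, hm.of_dvd (pow_dvd_pow _ (Nat.le_add_left k f))⟩
  have hpp := Nat.prime_iff_prime_int.1 hp
  have hpg : (p : ℤ) ∣ g - 1 := (dvd_pow_self _ (by lia)).trans h₁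
  intro i
  induction i with
  | zero => exact ⟨0, by simpa using ha⟩
  | succ i ih =>
    obtain ⟨m, hm⟩ := ih
    obtain ⟨⟨c, hc⟩, hc'⟩ := exact_dvd_pow_prime_pow_sub_one hp hf hf2 h₁ h₂ i
    have hpc : ¬ (p : ℤ) ∣ c := fun h => hc' (by rw [hc, pow_succ]; exact mul_dvd_mul_left _ h)
    obtain ⟨t, ht⟩ := hm.symm.dvd
    have hb : ¬ (p : ℤ) ∣ w * g ^ m * c := fun h => (hpp.dvd_or_dvd h).elim
      (fun h => (hpp.dvd_or_dvd h).elim hw (not_dvd_pow_of_dvd_sub_one hp hpg m)) hpc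
    obtain ⟨u, v, huv⟩ := (hpp.coprime_iff_not_dvd).2 hb
    -- Multiplying by g^(p^i j) adds w g^m c j p^(f+i) modulo p^(f+i+1), so j must be t/(w g^m c)
    -- modulo p.
    obtain ⟨j, l, hj⟩ : ∃ (j : ℕ) (l : ℤ), (j : ℤ) = v * t - p * l := by
      refine ⟨((v * t) % p).toNat, v * t / p, ?_⟩
      rw [Int.toNat_of_nonneg (Int.emod_nonneg _ (by exact_mod_cast hp.ne_zero)), Int.emod_def]
    obtain ⟨s, hs⟩ := sq_dvd_one_add_pow_sub ((p : ℤ) ^ (f + i) * c) j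
    rw [← hc, add_sub_cancel, ← pow_mul] at hs
    refine ⟨m + p ^ i * j, Int.ModEq.symm (Int.modEq_iff_dvd.2 ?_)⟩
    obtain ⟨n, hn⟩ : ∃ n, f + i = n + 1 := ⟨f + i - 1, by lia⟩
    rw [show f + (i + 1) = n + 1 + 1 by lia]
    rw [hc, hn] at hs
    rw [hn] at ht
    rw [pow_add]
    refine ⟨u * t + w * g ^ m * c * l - w * g ^ m * (p : ℤ) ^ n * c ^ 2 * s, ?_⟩
    linear_combination ht - (w * g ^ m) * hs - (p : ℤ) ^ (n + 1) * t * huv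
      - (w * g ^ m) * ((p : ℤ) ^ (n + 1) * c) * hj

end Lifting

/-! ### The number n⋆ and distance to ±1 -/

theorem units_eq_one_or (σ : ℤˣ) : (σ : ℤ) = 1 ∨ (σ : ℤ) = -1 := Int.isUnit_iff.1 σ.isUnit

/-- The congruence to which divisibility of `nStar` by `p ^ e` amounts is one modulo
`p ^ (e + levelShift p)`. -/
def levelShift (p : ℕ) : ℕ := if p = 2 then 1 else 0

theorem exists_units_modEq_iff {x n : ℤ} :
    (∃ σ : ℤˣ, x ≡ σ [ZMOD n]) ↔ n ∣ x - 1 ∨ n ∣ x + 1 := by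
  constructor
  · rintro ⟨σ, h⟩
    have := h.symm.dvd
    rcases units_eq_one_or σ with hσ | hσ <;> rw [hσ] at this
    · exact Or.inl this
    · exact Or.inr (by simpa using this)
  · rintro (h | h)
    · exact ⟨1, (Int.modEq_iff_dvd.2 (by simpa using h)).symm⟩
    · exact ⟨-1, (Int.modEq_iff_dvd.2 (by simpa using h)).symm⟩

theorem Prime.pow_dvd_mul_iff_of_not_both {R : Type*} [CommMonoidWithZero R] [IsCancelMulZero R]
    {p a b : R} (hp : Prime p) (h : ¬ (p ∣ a ∧ p ∣ b)) (e : ℕ) :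
    p ^ e ∣ a * b ↔ p ^ e ∣ a ∨ p ^ e ∣ b := by
  refine ⟨fun hab => ?_, fun h => h.elim (·.mul_right b) (·.mul_left a)⟩
  by_cases ha : p ∣ a
  · exact Or.inl (hp.pow_dvd_of_dvd_mul_right e (fun hb => h ⟨ha, hb⟩) hab)
  · exact Or.inr (hp.pow_dvd_of_dvd_mul_left e ha hab)

theorem nStar_of_odd {x : ℤ} (hx : Odd x) : 4 * nStar x = x ^ 2 - 1 := by
  rw [nStar, if_neg (Int.not_even_iff_odd.2 hx)]
  obtain ⟨k, rfl⟩ := hx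
  rw [show (2 * k + 1) ^ 2 - 1 = 4 * (k * (k + 1)) by ring, Int.mul_ediv_cancel_left _ (by simp)]

theorem nStar_of_even {x : ℤ} (hx : Even x) : nStar x = x ^ 2 - 1 := if_pos hx

/-- For odd p, at most one of x - 1 and x + 1 is divisible by p, and 4 is invertible. For p = 2 and
x = 2k + 1, x⋆ = k(k + 1) has coprime factors, and the halving costs one power of 2; for x even both
sides fail. -/
theorem pow_dvd_nStar_iff {p e : ℕ} (hp : p.Prime) (he : 1 ≤ e) (x : ℤ) :
    (p : ℤ) ^ e ∣ nStar x ↔ ∃ σ : ℤˣ, x ≡ σ [ZMOD (p : ℤ) ^ (e + levelShift p)] := by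
  have hpp := Nat.prime_iff_prime_int.1 hp
  rw [exists_units_modEq_iff]
  rcases eq_or_ne p 2 with rfl | hp2
  · rw [levelShift, if_pos rfl]
    push_cast
    have h2 : (2 : ℤ) ∣ 2 ^ e := dvd_pow_self _ (by lia)
    rcases Int.even_or_odd x with hx | hx
    · obtain ⟨k, rfl⟩ := hx
      have h2' : (2 : ℤ) ∣ 2 ^ (e + 1) := dvd_pow_self _ (by lia)
      rw [nStar_of_even ⟨k, rfl⟩]
      refine iff_of_false (fun h => ?_) (fun h => h.elim (fun h => ?_) (fun h => ?_))
      · have := h2.trans h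
        ring_nf at this
        lia
      · have := h2'.trans h; lia
      · have := h2'.trans h; lia
    · have h4 := nStar_of_odd hx
      obtain ⟨k, rfl⟩ := hx
      have hk : nStar (2 * k + 1) = k * (k + 1) := by linarith
      rw [hk, Int.prime_two.pow_dvd_mul_iff_of_not_both (by lia), pow_succ',
        show 2 * k + 1 - 1 = 2 * k by ring, show 2 * k + 1 + 1 = 2 * (k + 1) by ring,
        mul_dvd_mul_iff_left two_ne_zero, mul_dvd_mul_iff_left two_ne_zero]
  · rw [levelShift, if_neg hp2, add_zero]
    have hp2' : ¬ (p : ℤ) ∣ 2 := fun h => hp2 (GolombSpace.eq_of_prime_natCast_dvd hp Nat.prime_two h)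
    rw [← hpp.pow_dvd_mul_iff_of_not_both (fun h => hp2' (by simpa using dvd_sub h.2 h.1)),
      show (x - 1) * (x + 1) = x ^ 2 - 1 by ring]
    rcases Int.even_or_odd x with hx | hx
    · rw [nStar_of_even hx]
    · rw [← nStar_of_odd hx]
      refine ⟨fun h => h.mul_left 4, hpp.pow_dvd_of_dvd_mul_left e fun h => hp2' ?_⟩
      exact hpp.dvd_of_dvd_pow (n := 2) (by simpa using h)

theorem nStar_pos {x : ℤ} (hx : 1 < |x|) : 0 < nStar x := by
  have h : 1 < x ^ 2 := by rwa [one_lt_sq_iff_one_lt_abs]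
  rcases Int.even_or_odd x with hx | hx
  · rw [nStar_of_even hx]; lia
  · have := nStar_of_odd hx; lia

theorem nStar_natCast_ne_zero {r : ℕ} (hr : r.Prime) : nStar r ≠ 0 :=
  (nStar_pos (by rw [Nat.abs_cast]; exact_mod_cast hr.one_lt)).ne'

theorem two_le_add_levelShift {p e : ℕ} (he : 1 ≤ e) (hp : p = 2) : 2 ≤ e + levelShift p := by
  rw [levelShift, if_pos hp]; lia

theorem not_dvd_of_pow_dvd_nStar {p e : ℕ} (hp : p.Prime) (he : 1 ≤ e) {x : ℤ}
    (h : (p : ℤ) ^ e ∣ nStar x) : ¬ (p : ℤ) ∣ x := by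
  obtain ⟨σ, hσ⟩ := (pow_dvd_nStar_iff hp he x).1 h
  rw [(hσ.of_dvd (dvd_pow_self _ (by lia))).dvd_iff]
  exact GolombSpace.not_prime_dvd_of_isUnit σ.isUnit hp

theorem pow_dvd_nStar_of_powAdherent {p e : ℕ} (hp : p.Prime) (he : 1 ≤ e) {x y : ℤ}
    (hx : (p : ℤ) ^ e ∣ nStar x) (h : PowAdherent p x y) : (p : ℤ) ^ e ∣ nStar y := by
  rw [pow_dvd_nStar_iff hp he] at hx ⊢
  obtain ⟨σ, hσ⟩ := hx
  obtain ⟨τ, m, hτ⟩ := h (e + levelShift p)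
  refine ⟨τ * σ ^ m, hτ.trans ?_⟩
  push_cast
  exact (hσ.pow m).mul_left _

/-- Up to sign, x generates a dense subgroup of 1 + p^f ℤ_p with f = e + `levelShift p`, and y lies
in that group up to sign. -/
theorem powAdherent_of_pow_dvd_nStar {p e : ℕ} (hp : p.Prime) (he : 1 ≤ e) {x y : ℤ}
    (hx : (p : ℤ) ^ e ∣ nStar x) (hx' : ¬ (p : ℤ) ^ (e + 1) ∣ nStar x)
    (hy : (p : ℤ) ^ e ∣ nStar y) : PowAdherent p x y := by
  rw [pow_dvd_nStar_iff hp he] at hx hy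
  rw [pow_dvd_nStar_iff hp (by lia)] at hx'
  obtain ⟨σ, hσ⟩ := hx
  obtain ⟨τ, hτ⟩ := hy
  have hσσ : (σ : ℤ) * σ = 1 := by rw [← Units.val_mul, Int.units_mul_self, Units.val_one]
  intro k
  have h₁ : (p : ℤ) ^ (e + levelShift p) ∣ σ * x - 1 := by
    have := (hσ.mul_left σ).symm.dvd
    rwa [hσσ] at this
  have h₂ : ¬ (p : ℤ) ^ (e + levelShift p + 1) ∣ σ * x - 1 := fun h => by
    refine hx' ⟨σ, ?_⟩
    have h' := ((Int.modEq_iff_dvd.2 h).mul_left σ).symm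
    rwa [← mul_assoc, hσσ, one_mul, mul_one, add_right_comm] at h'
  obtain ⟨m, hm⟩ := exists_modEq_mul_pow hp (by lia) (two_le_add_levelShift he) h₁ h₂
    (GolombSpace.not_prime_dvd_of_isUnit τ.isUnit hp) hτ k
  exact ⟨τ * σ ^ m, m, by push_cast; rwa [mul_assoc, ← mul_pow]⟩

/-! ### Auxiliary primes from Dirichlet's theorem -/

theorem exists_prime_modEq_pow {p : ℕ} (hp : p.Prime) {a : ℤ} (ha : ¬ (p : ℤ) ∣ a) (k : ℕ) :
    ∃ r : ℕ, r.Prime ∧ (r : ℤ) ≡ a [ZMOD (p : ℤ) ^ k] := by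
  obtain ⟨r, -, hr, h⟩ := Nat.forall_exists_prime_gt_and_zmodEq 0 (q := p ^ k) (a := a)
    (pow_ne_zero _ hp.ne_zero)
    (by push_cast; exact (GolombSpace.isCoprime_pow_of_not_dvd hp ha k).symm)
  exact ⟨r, hr, by push_cast at h; exact h⟩

theorem exists_prime_exact_dvd_nStar {p e : ℕ} (hp : p.Prime) (he : 1 ≤ e) :
    ∃ r : ℕ, r.Prime ∧ (p : ℤ) ^ e ∣ nStar r ∧ ¬ (p : ℤ) ^ (e + 1) ∣ nStar r := by
  set f := e + levelShift p with hf
  have hpp := Nat.prime_iff_prime_int.1 hp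
  have hp0 : (p : ℤ) ^ f ≠ 0 := pow_ne_zero _ hpp.ne_zero
  have hpf : (p : ℤ) ∣ (p : ℤ) ^ f := dvd_pow_self _ (by lia)
  obtain ⟨r, hr, hrp⟩ := exists_prime_modEq_pow hp (a := 1 + (p : ℤ) ^ f)
    (fun h => hpp.not_dvd_one (by simpa using dvd_sub h hpf)) (f + 1)
  refine ⟨r, hr, ?_, fun h => ?_⟩
  · rw [pow_dvd_nStar_iff hp he]
    refine ⟨1, (hrp.of_dvd (pow_dvd_pow _ f.le_succ)).trans ?_⟩
    exact (Int.modEq_iff_dvd.2 (by simp)).symm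
  · rw [pow_dvd_nStar_iff hp (by lia), add_right_comm, ← hf] at h
    obtain ⟨σ, hσ⟩ := h
    have h := (hrp.symm.trans hσ).symm.dvd
    rcases units_eq_one_or σ with h1 | h1 <;> rw [h1] at h
    · rw [add_sub_cancel_left, pow_succ] at h
      exact hpp.not_isUnit (isUnit_of_dvd_one ((mul_dvd_mul_iff_left hp0).1 (by simpa using h)))
    -- The sign -1 would force p = 2 and f = 1, but f ≥ 2 when p = 2.
    · have h2 : (p : ℤ) ^ f ∣ 2 := by
        have := dvd_sub ((pow_dvd_pow (p : ℤ) f.le_succ).trans h) dvd_rfl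
        ring_nf at this
        exact this
      have hp2 := GolombSpace.eq_of_prime_natCast_dvd hp Nat.prime_two (hpf.trans h2)
      have h4 := (pow_dvd_pow (p : ℤ) (two_le_add_levelShift he hp2)).trans h2
      rw [hp2] at h4
      norm_num at h4

theorem two_dvd_nStar_of_odd {x : ℤ} (hx : ¬ (2 : ℤ) ∣ x) : (2 : ℤ) ∣ nStar x := by
  have h := (pow_dvd_nStar_iff Nat.prime_two le_rfl x).2 (exists_units_modEq_iff.2 (by
    simp [levelShift]; lia))
  simpa using h

/-- If `p ∤ nStar r`, then two primes which are incomparable for `p`-adic adherence are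
`p`-adically adherent to the `± r ^ m`. -/
theorem exists_incomparable_of_not_dvd_nStar {p r : ℕ} (hp : p.Prime) (hr : r.Prime)
    (hpr : ¬ (p : ℤ) ∣ r) (h : ¬ (p : ℤ) ∣ nStar r) :
    ∃ a b : ℕ, a.Prime ∧ b.Prime ∧ PowAdherent p r a ∧ PowAdherent p r b ∧
      ¬ PowAdherent p a b ∧ ¬ PowAdherent p b a := by
  have hpp := Nat.prime_iff_prime_int.1 hp
  have : Fact p.Prime := ⟨hp⟩
  have hp2 : p ≠ 2 := by
    rintro rfl
    exact h (two_dvd_nStar_of_odd hpr)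
  have hp2' : ¬ (p : ℤ) ∣ 2 := fun h =>
    hp2 (GolombSpace.eq_of_prime_natCast_dvd hp Nat.prime_two h)
  -- The factor p - 1 makes g ≡ 1 modulo p; the factor 2 kills signs.
  set g : ℤ := (r : ℤ) ^ (2 * (p - 1)) with hg
  have hpr' : (r : ℤ) ^ p ≡ r [ZMOD p] := by
    rw [← ZMod.intCast_eq_intCast_iff]; push_cast; exact ZMod.pow_card _
  have hpg : (p : ℤ) ∣ g - 1 := by
    have : (r : ℤ) ^ (p - 1) ≡ 1 [ZMOD p] :=
      Int.ModEq.pow_card_sub_one_eq_one hp ((hpp.coprime_iff_not_dvd).2 hpr).symm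
    have := (this.pow 2).symm.dvd
    rwa [← pow_mul, one_pow, mul_comm] at this
  have hg0 : g - 1 ≠ 0 := by
    have : 1 < r ^ (2 * (p - 1)) := Nat.one_lt_pow (by have := hp.two_le; lia) hr.one_lt
    have : 1 < g := by rw [hg]; exact_mod_cast this
    lia
  obtain ⟨f, c, hc, hpc, -⟩ := GolombSpace.exists_eq_pow_mul hp hg0
  have hf : 1 ≤ f := by
    rcases Nat.eq_zero_or_pos f with rfl | hf
    · rw [pow_zero, one_mul] at hc
      exact absurd (hc ▸ hpg) hpc
    · exact hf
  have h₁ : (p : ℤ) ^ f ∣ g - 1 := ⟨c, hc⟩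
  have h₂ : ¬ (p : ℤ) ^ (f + 1) ∣ g - 1 := by
    rw [hc, pow_succ, mul_dvd_mul_iff_left (pow_ne_zero _ hpp.ne_zero)]
    exact hpc
  have hgp : g ^ p ≡ 1 [ZMOD (p : ℤ) ^ (f + 1)] :=
    (Int.modEq_iff_dvd.2 (exact_dvd_pow_sub_one hp hf (fun h => absurd h hp2) h₁ h₂).1).symm
  have hdense : ∀ {w : ℤ} {i a : ℕ}, w = (r : ℤ) ^ i → (a : ℤ) ≡ w [ZMOD (p : ℤ) ^ f] →
      PowAdherent p r a := by
    rintro w i a rfl ha k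
    obtain ⟨m, hm⟩ := exists_modEq_mul_pow hp hf (fun h => absurd h hp2) h₁ h₂
      (fun h => hpr (hpp.dvd_of_dvd_pow h)) ha k
    exact ⟨1, i + 2 * (p - 1) * m, by rwa [Units.val_one, one_mul, pow_add, pow_mul]⟩
  -- Modulo p^(f+1), g has order p, while every ± (r^p)^m is killed by 2(p - 1), prime to p. So a ≡
  -- r^p cannot produce b ≡ g; nor can b, being 1 modulo p, produce a ≡ r, which is not ±1 modulo p.
  obtain ⟨a, hap, ha⟩ := exists_prime_modEq_pow hp (a := (r : ℤ) ^ p)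
    (fun h => hpr (hpp.dvd_of_dvd_pow h)) (f + 1)
  obtain ⟨b, hbp, hb⟩ := exists_prime_modEq_pow hp (a := g)
    (by simpa using not_dvd_pow_of_dvd_sub_one hp hpg 1) (f + 1)
  have hff : (p : ℤ) ^ f ∣ (p : ℤ) ^ (f + 1) := pow_dvd_pow _ f.le_succ
  refine ⟨a, b, hap, hbp, hdense rfl (ha.of_dvd hff), hdense hg (hb.of_dvd hff),
    fun hab => ?_, fun hba => h ?_⟩
  · obtain ⟨σ, m, hσ⟩ := hab (f + 1)
    have hσ2 : (σ : ℤ) ^ 2 = 1 := by rw [← Units.val_pow_eq_pow_val, Int.units_sq, Units.val_one]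
    have h3 := ((hb.symm.trans hσ).trans ((ha.pow m).mul_left σ)).pow (2 * (p - 1))
    rw [mul_pow, pow_mul (σ : ℤ), hσ2, one_pow, one_mul,
      show (((r : ℤ) ^ p) ^ m) ^ (2 * (p - 1)) = (g ^ p) ^ m by rw [hg]; ring] at h3
    have h4 := h3.trans (hgp.pow m)
    rw [one_pow] at h4
    have h5 : g ^ 2 ≡ 1 [ZMOD (p : ℤ) ^ (f + 1)] := by
      have e1 := h4.mul_right (g ^ 2)
      rw [← pow_add, one_mul, show 2 * (p - 1) + 2 = p * 2 by have := hp.two_le; lia,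
        pow_mul] at e1
      exact e1.symm.trans (by simpa using hgp.pow 2)
    have h6 := h5.symm.dvd
    rw [show g ^ 2 - 1 = (g - 1) * (g - 1 + 2) by ring] at h6
    exact h₂ (hpp.pow_dvd_of_dvd_mul_right _
      (fun h => hp2' (by simpa using dvd_sub h hpg)) h6)
  · have hp1 : ∀ {x y : ℤ}, x ≡ y [ZMOD (p : ℤ) ^ (f + 1)] → x ≡ y [ZMOD p] :=
      fun h => h.of_dvd (dvd_pow_self _ f.succ_ne_zero)
    have hpb : (p : ℤ) ^ 1 ∣ nStar b := (pow_dvd_nStar_iff hp le_rfl _).2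
      ⟨1, by simpa [levelShift, hp2] using (hp1 hb).trans (Int.modEq_iff_dvd.2 hpg).symm⟩
    obtain ⟨σ, hσ⟩ := (pow_dvd_nStar_iff hp le_rfl _).1
      (pow_dvd_nStar_of_powAdherent hp le_rfl hpb hba)
    have := (pow_dvd_nStar_iff hp le_rfl (r : ℤ)).2 ⟨σ, ?_⟩
    · simpa using this
    · simp only [levelShift, hp2, if_false, add_zero, pow_one] at hσ ⊢
      exact (hpr'.symm.trans (hp1 ha).symm).trans hσ

theorem exists_eq_unit_mul_pow_iff {r : ℕ} (hr : r.Prime) {x : ℤ} (hx : x ≠ 0) :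
    (∃ (σ : ℤˣ) (m : ℕ), x = σ * (r : ℤ) ^ m) ↔
      ∀ l : ℕ, l.Prime → (l : ℤ) ∣ x → l = r := by
  constructor
  · rintro ⟨σ, m, rfl⟩ l hl hlx
    rw [Units.dvd_mul_left] at hlx
    exact GolombSpace.eq_of_prime_natCast_dvd hl hr
      ((Nat.prime_iff_prime_int.1 hl).dvd_of_dvd_pow hlx)
  · intro h
    have hn := Nat.eq_prime_pow_of_unique_prime_dvd (n := x.natAbs) (p := r) (by simpa using hx)
      fun hl hlx => h _ hl (Int.natCast_dvd.2 hlx)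
    rcases Int.natAbs_eq x with h1 | h1 <;> rw [hn] at h1
    · exact ⟨1, _, by simpa using h1⟩
    · exact ⟨-1, _, by simpa using h1⟩

/-! ### Invariance of the prime powers dividing n⋆ -/

namespace GolombSpace

variable {h : GolombSpace ℤ ≃ₜ GolombSpace ℤ} {p q r s : ℕ}

theorem MapsMultiples.exists_apply_eq_unit_mul_pow (hr : r.Prime) (hs : s.Prime)
    (H : MapsMultiples h r s) {x : GolombSpace ℤ}
    (hx : ∃ (σ : ℤˣ) (m : ℕ), x.val = σ * (r : ℤ) ^ m) :
    ∃ (σ : ℤˣ) (m : ℕ), (h x).val = σ * (s : ℤ) ^ m := by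
  rw [exists_eq_unit_mul_pow_iff hr x.ne_zero] at hx
  rw [exists_eq_unit_mul_pow_iff hs (h x).ne_zero]
  intro l hl hlx
  obtain ⟨l', hl', Hl⟩ := exists_mapsMultiples h.symm hl
  obtain rfl := hx l' hl' (Hl.symm x |>.2 hlx)
  exact Hl.symm.right_unique hl hs H

theorem MapsMultiples.ne (hp : p.Prime) (hr : r.Prime) (hs : s.Prime)
    (H : MapsMultiples h p q) (Hr : MapsMultiples h r s) (hpr : p ≠ r) : q ≠ s := by
  rintro rfl
  exact hpr (H.left_unique hp hr Hr)

theorem not_dvd_of_ne (hp : p.Prime) (hr : r.Prime) (hpr : p ≠ r) : ¬ (p : ℤ) ∣ r :=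
  fun h => hpr (eq_of_prime_natCast_dvd hp hr h)

theorem MapsMultiples.powAdherent (hp : p.Prime) (hq : q.Prime) (hr : r.Prime) (hs : s.Prime)
    (H : MapsMultiples h p q) (Hr : MapsMultiples h r s) (hpr : p ≠ r) {y : GolombSpace ℤ}
    (hy : PowAdherent p r y.val) : PowAdherent q s (h y).val := by
  intro k
  obtain ⟨j, hj⟩ := H.exists_pow_dvd_sub hp hq (hy.not_dvd hp (not_dvd_of_ne hp hr hpr)) k
  obtain ⟨σ, m, hm⟩ := hy j
  have hr0 : (r : ℤ) ≠ 0 := by exact_mod_cast hr.ne_zero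
  obtain ⟨τ, n, hn⟩ := Hr.exists_apply_eq_unit_mul_pow hr hs
    (x := ⟨σ * (r : ℤ) ^ m, mul_ne_zero σ.ne_zero (pow_ne_zero _ hr0)⟩) ⟨σ, m, rfl⟩
  exact ⟨τ, n, Int.modEq_iff_dvd.2 (hn ▸ hj _ hm.dvd)⟩

/-- Adherence of one prime to the powers of another one is invariant under homeomorphisms. -/
theorem MapsMultiples.powAdherent_natCast (hp : p.Prime) (hq : q.Prime) (hr : r.Prime)
    (hs : s.Prime) (H : MapsMultiples h p q) (Hr : MapsMultiples h r s) (hpr : p ≠ r) {a b : ℕ}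
    (ha : a.Prime) (hb : b.Prime) (Ha : MapsMultiples h a b)
    (hra : PowAdherent p r a) : PowAdherent q s b := by
  have hb0 : (b : ℤ) ≠ 0 := by exact_mod_cast hb.ne_zero
  -- The preimage of b need not be a, only ± a power of a; transitivity of adherence bridges the
  -- gap.
  obtain ⟨σ, m, hm⟩ := Ha.symm.exists_apply_eq_unit_mul_pow hb ha (x := ⟨b, hb0⟩)
    ⟨1, 1, by simp⟩
  have := H.powAdherent hp hq hr hs Hr hpr (y := h.symm ⟨b, hb0⟩)
    (hra.trans (hm ▸ powAdherent_unit_mul_pow p a σ m))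
  rwa [h.apply_symm_apply] at this

theorem exists_exact_pow_dvd (hp : p.Prime) {N : ℤ} (hN : N ≠ 0) :
    ∃ e, (p : ℤ) ^ e ∣ N ∧ ¬ (p : ℤ) ^ (e + 1) ∣ N := by
  obtain ⟨e, N, rfl, hpN, -⟩ := exists_eq_pow_mul hp hN
  refine ⟨e, dvd_mul_right _ _, ?_⟩
  rwa [pow_succ, mul_dvd_mul_iff_left (pow_ne_zero _ (by exact_mod_cast hp.ne_zero))]

/-- Those primes `r` with `p ∣ nStar r` are linearly ordered by `p`-adic adherence. -/
theorem powAdherent_total (hp : p.Prime) {a b : ℕ} (ha : a.Prime) (hb : b.Prime)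
    (hpa : (p : ℤ) ∣ nStar a) (hpb : (p : ℤ) ∣ nStar b) :
    PowAdherent p a b ∨ PowAdherent p b a := by
  have hpos : ∀ {e : ℕ} {N : ℤ}, (p : ℤ) ∣ N → ¬ (p : ℤ) ^ (e + 1) ∣ N → 1 ≤ e := by
    intro e N h h'
    by_contra he
    exact h' (by simpa [Nat.lt_one_iff.1 (not_le.1 he)] using h)
  obtain ⟨e, he, he'⟩ := exists_exact_pow_dvd hp (nStar_natCast_ne_zero ha)
  obtain ⟨f, hf, hf'⟩ := exists_exact_pow_dvd hp (nStar_natCast_ne_zero hb)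
  rcases le_total e f with hef | hef
  · exact Or.inl (powAdherent_of_pow_dvd_nStar hp (hpos hpa he') he he'
      ((pow_dvd_pow _ hef).trans hf))
  · exact Or.inr (powAdherent_of_pow_dvd_nStar hp (hpos hpb hf') hf hf'
      ((pow_dvd_pow _ hef).trans he))

/-- If q ∤ s⋆, two incomparable primes adherent to the ± s^m pull back to primes adherent to the ±
r^m. Those are comparable because p ∣ r⋆, and comparability is invariant. -/
theorem MapsMultiples.dvd_nStar (hp : p.Prime) (hq : q.Prime) (hr : r.Prime) (hs : s.Prime)
    (H : MapsMultiples h p q) (Hr : MapsMultiples h r s) (hpr : (p : ℤ) ∣ nStar r) :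
    (q : ℤ) ∣ nStar s := by
  have hpr1 : (p : ℤ) ^ 1 ∣ nStar r := by simpa using hpr
  have hne : p ≠ r := by
    rintro rfl
    exact not_dvd_of_pow_dvd_nStar hp le_rfl hpr1 dvd_rfl
  have hne' := H.ne hp hr hs Hr hne
  have hqs := not_dvd_of_ne hq hs hne'
  by_contra hnot
  obtain ⟨a, b, ha, hb, hsa, hsb, hab, hba⟩ :=
    exists_incomparable_of_not_dvd_nStar hq hs hqs hnot
  obtain ⟨a', ha', Ha⟩ := exists_mapsMultiples h.symm ha
  obtain ⟨b', hb', Hb⟩ := exists_mapsMultiples h.symm hb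
  have hra := H.symm.powAdherent_natCast hq hp hs hr Hr.symm hne' ha ha' Ha hsa
  have hrb := H.symm.powAdherent_natCast hq hp hs hr Hr.symm hne' hb hb' Hb hsb
  have hpa := pow_dvd_nStar_of_powAdherent hp le_rfl hpr1 hra
  have hpb := pow_dvd_nStar_of_powAdherent hp le_rfl hpr1 hrb
  have hne_of : ∀ {a : ℕ}, a.Prime → (p : ℤ) ^ 1 ∣ nStar a → p ≠ a := by
    rintro _ - h rfl
    exact not_dvd_of_pow_dvd_nStar hp le_rfl h dvd_rfl
  rcases powAdherent_total hp ha' hb' (by simpa using hpa) (by simpa using hpb) with h1 | h1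
  · exact hab (H.powAdherent_natCast hp hq ha' ha Ha.symm (hne_of ha' hpa) hb' hb Hb.symm h1)
  · exact hba (H.powAdherent_natCast hp hq hb' hb Hb.symm (hne_of hb' hpb) ha' ha Ha.symm h1)

theorem MapsMultiples.pow_dvd_nStar (hp : p.Prime) (hq : q.Prime) (H : MapsMultiples h p q)
    {e : ℕ} (he : 1 ≤ e) (hr : r.Prime) (hs : s.Prime) (Hr : MapsMultiples h r s)
    (hpr : (p : ℤ) ^ e ∣ nStar r) : (q : ℤ) ^ e ∣ nStar s := by
  induction e, he using Nat.le_induction generalizing r s with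
  | base => simpa using H.dvd_nStar hp hq hr hs Hr (by simpa using hpr)
  | succ e he ih =>
    obtain ⟨a, ha, hpa, hpa'⟩ := exists_prime_exact_dvd_nStar hp he
    obtain ⟨b, hb, Ha⟩ := exists_mapsMultiples h ha
    have hqb := ih ha hb Ha hpa
    have hpr' := (pow_dvd_pow (p : ℤ) e.le_succ).trans hpr
    have hqs := ih hr hs Hr hpr'
    have hpr0 : p ≠ r := by
      rintro rfl
      exact not_dvd_of_pow_dvd_nStar hp he hpr' dvd_rfl
    by_contra hnot
    -- If q^e exactly divided s⋆, then b would be adherent to the ± s^m, hence a to the ± r^m, and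
    -- p^(e+1) would divide a⋆.
    have h1 := powAdherent_of_pow_dvd_nStar hq he hqs hnot hqb
    have h2 := H.symm.powAdherent_natCast hq hp hs hr Hr.symm (H.ne hp hr hs Hr hpr0) hb ha
      Ha.symm h1
    exact hpa' (pow_dvd_nStar_of_powAdherent hp (by lia) hpr h2)

theorem MapsMultiples.pow_dvd_nStar_apply (hp : p.Prime) (hq : q.Prime) (H : MapsMultiples h p q)
    {n : GolombSpace ℤ} {e : ℕ} (hpn : (p : ℤ) ^ e ∣ nStar n.val) :
    (q : ℤ) ^ e ∣ nStar (h n).val := by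
  rcases Nat.eq_zero_or_pos e with rfl | he
  · simp
  obtain ⟨r, hr, hpr, hpr'⟩ := exists_prime_exact_dvd_nStar hp he
  obtain ⟨s, hs, Hr⟩ := exists_mapsMultiples h hr
  have hne : p ≠ r := by
    rintro rfl
    exact not_dvd_of_pow_dvd_nStar hp he hpr dvd_rfl
  exact pow_dvd_nStar_of_powAdherent hq he (H.pow_dvd_nStar hp hq he hr hs Hr hpr)
    (H.powAdherent hp hq hr hs Hr hne (powAdherent_of_pow_dvd_nStar hp he hpr hpr' hpn))

theorem MapsMultiples.pow_dvd_nStar_apply_iff (hp : p.Prime) (hq : q.Prime)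
    (H : MapsMultiples h p q) (n : GolombSpace ℤ) (e : ℕ) :
    (q : ℤ) ^ e ∣ nStar (h n).val ↔ (p : ℤ) ^ e ∣ nStar n.val :=
  ⟨fun hd => by simpa using H.symm.pow_dvd_nStar_apply hq hp hd, H.pow_dvd_nStar_apply hp hq⟩

theorem extend_coe (h : GolombSpace ℤ → GolombSpace ℤ) (x : GolombSpace ℤ) :
    extend h x.val = (h x).val := by
  rw [extend, dif_neg x.ne_zero]

theorem MapsMultiples.image_extend (H : MapsMultiples h p q) :
    extend h '' (Ideal.span {(p : ℤ)} : Set ℤ) = (Ideal.span {(q : ℤ)} : Set ℤ) := by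
  ext y
  simp only [Set.mem_image, SetLike.mem_coe, Ideal.mem_span_singleton]
  constructor
  · rintro ⟨x, hx, rfl⟩
    by_cases hx0 : x = 0
    · simp [extend, hx0]
    · rw [extend_coe h ⟨x, hx0⟩]
      exact (H _).1 hx
  · intro hy
    by_cases hy0 : y = 0
    · exact ⟨0, dvd_zero _, by simp [extend, hy0]⟩
    · refine ⟨(h.symm ⟨y, hy0⟩).val, (H.symm _).1 hy, ?_⟩
      rw [extend_coe, h.apply_symm_apply]

theorem one_lt_abs_iff (x : GolombSpace ℤ) : 1 < |x.val| ↔ ¬ IsUnit x.val := by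
  have := Int.one_le_abs x.ne_zero
  rw [Int.isUnit_iff, ← abs_eq (zero_le_one' ℤ)]
  lia

end GolombSpace

/-! ### Comparison of the factorizations -/

open GolombSpace in
theorem mainTheorem12 (h : GolombSpace ℤ ≃ₜ GolombSpace ℤ) (n : GolombSpace ℤ) (hn : 1 < |n.val|)
    (t : ℕ) (p e : Fin t → ℕ) (hp : ∀ i, (p i).Prime) (hp_inj : Function.Injective p)
    (he : ∀ i, 0 < e i) (hfac : nStar n.val = ∏ i, (p i : ℤ) ^ e i) :
    ∃ q : Fin t → ℕ, (∀ i, (q i).Prime) ∧ Function.Injective q ∧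
      (∀ i, GolombSpace.extend h '' (Ideal.span {(p i : ℤ)} : Set ℤ)
        = (Ideal.span {(q i : ℤ)} : Set ℤ)) ∧
      nStar (h n).val = ∏ i, (q i : ℤ) ^ e i := by
  choose q hq H using fun i => exists_mapsMultiples h (hp i)
  have hq_inj : Function.Injective q := fun i j hij =>
    hp_inj ((H i).left_unique (hp i) (hp j) (hij ▸ H j))
  refine ⟨q, hq, hq_inj, fun i => (H i).image_extend, ?_⟩
  have hn0 := nStar_pos hn
  have hhn0 := nStar_pos ((one_lt_abs_iff (h n)).2
    ((isUnit_apply_iff h).not.2 ((one_lt_abs_iff n).1 hn)))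
  obtain ⟨M, hM⟩ := Int.eq_ofNat_of_zero_le hhn0.le
  have hfac_dvd : ∀ {p : Fin t → ℕ}, (∀ i, (p i).Prime) → Function.Injective p → ∀ i k,
      (p i : ℤ) ^ k ∣ ∏ i, (p i : ℤ) ^ e i ↔ k ≤ e i := by
    intro p hp hp_inj i k
    have hpi := Nat.prime_iff_prime_int.1 (hp i)
    rw [← Finset.mul_prod_erase _ _ (Finset.mem_univ i)]
    refine ⟨fun hd => ?_, fun hk => (pow_dvd_pow _ hk).mul_right _⟩
    refine (pow_dvd_pow_iff hpi.ne_zero hpi.not_isUnit).1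
      (hpi.pow_dvd_of_dvd_mul_right _ (fun hd' => ?_) hd)
    obtain ⟨j, hj, hd''⟩ := (Prime.dvd_finsetProd_iff hpi _).1 hd'
    exact Finset.ne_of_mem_erase hj (hp_inj
      (eq_of_prime_natCast_dvd (hp i) (hp j) (hpi.dvd_of_dvd_pow hd''))).symm
  have hdvd_eq : ∀ {p : Fin t → ℕ}, (∀ i, (p i).Prime) → ∀ {l k : ℕ}, l.Prime → 0 < k →
      (l : ℤ) ^ k ∣ ∏ i, (p i : ℤ) ^ e i → ∃ i, p i = l := by
    intro p hp l k hl hk hd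
    have hll := Nat.prime_iff_prime_int.1 hl
    obtain ⟨j, -, hj⟩ := (Prime.dvd_finsetProd_iff hll _).1 ((dvd_pow_self _ hk.ne').trans hd)
    exact ⟨j, (eq_of_prime_natCast_dvd hl (hp j) (hll.dvd_of_dvd_pow hj)).symm⟩
  -- As h(n)⋆ and the product are positive, equality can be tested on prime powers. A prime l
  -- dividing h(n)⋆ corresponds to a prime dividing n⋆, so it is one of the q_i.
  have key : ∀ l k : ℕ, l.Prime →
      ((l : ℤ) ^ k ∣ nStar (h n).val ↔ (l : ℤ) ^ k ∣ ∏ i, (q i : ℤ) ^ e i) := by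
    intro l k hl
    rcases Nat.eq_zero_or_pos k with rfl | hk
    · simp
    by_cases hlq : ∃ i, q i = l
    · obtain ⟨i, rfl⟩ := hlq
      rw [(H i).pow_dvd_nStar_apply_iff (hp i) (hq i), hfac, hfac_dvd hp hp_inj,
        hfac_dvd hq hq_inj]
    · refine iff_of_false (fun hd => hlq ?_) fun hd => hlq (hdvd_eq hq hl hk hd)
      obtain ⟨l', hl', Hl⟩ := exists_mapsMultiples h.symm hl
      replace Hl : MapsMultiples h l' l := Hl.symm
      rw [Hl.pow_dvd_nStar_apply_iff hl' hl, hfac] at hd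
      obtain ⟨i, rfl⟩ := hdvd_eq hp hl' hk hd
      exact ⟨i, (H i).right_unique (hq i) hl Hl⟩
  rw [hM] at key ⊢
  norm_cast at key ⊢
  exact Nat.dvd_antisymm ((Nat.dvd_iff_prime_pow_dvd_dvd _ _).2 fun l k hl => (key l k hl).1)
    ((Nat.dvd_iff_prime_pow_dvd_dvd _ _).2 fun l k hl => (key l k hl).2)
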